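/- Let $\mathbb T^3=\mathbb R^3/\mathbb Z^3$ be the standard flat torus, with its Riemannian volume measure, and let $$\psi(x,y,z)=\sin(2\pi(x+y))-\cos(2\pi(y-z))-\sin(2\pi(x+z)).$$ Then $\psi$ is an eigenfunction of the Laplacian on $\mathbb T^3$ with eigenvalue $8\pi^2$, that is, $\psi$ is smooth, not identically zero and satisfies $-\Delta\psi=8\pi^2\psi$. Moreover, writing $\psi_+=\psi\,\chi_{\{\psi>0\}}$ and $\psi_-=-\psi\,\chi_{\{\psi<0\}}$, where $\chi_A$ is the indicator function of $A$, one has $$\|\psi_+\|_{L^p(\mathbb T^3)}>\|\psi_-\|_{L^p(\mathbb T^3)}\qquad\text{for every } 1<p\le\infty .$$ In particular, $\|\psi_+\|_{L^p(\mathbb T^3)}\neq\|\psi_-\|_{L^p(\mathbb T^3)}$ for every $1<p\le\infty$. -/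

import Mathlib

open MeasureTheory
open scoped ENNReal ContDiff

namespace TorusLp

/-- The flat torus `𝕋³ = ℝ³ / ℤ³`. Its `volume` is the product of the Lebesgue measures on the
circles `ℝ / ℤ` (the Riemannian volume, of total mass `1`). -/
abbrev T3 : Type := UnitAddTorus (Fin 3)

/-- The quotient map `ℝ³ → ℝ³ / ℤ³`. -/
def proj (v : EuclideanSpace ℝ (Fin 3)) : T3 := fun i => (v i : UnitAddCircle)

/-- `u` is a real eigenfunction of the Laplacian of the flat torus with eigenvalue `l`: it is
smooth, not identically zero, and `-Δ u = l u`. Since the quotient map is a covering map and a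
local isometry, smoothness and the Laplacian are read off from the lift of `u` to `ℝ³`. -/
structure IsLaplaceEigenfunction (u : T3 → ℝ) (l : ℝ) : Prop where
  smooth : ContDiff ℝ ∞ (fun v : EuclideanSpace ℝ (Fin 3) => u (proj v))
  ne_zero : u ≠ 0
  eigen : ∀ v : EuclideanSpace ℝ (Fin 3),
    -Laplacian.laplacian (fun w : EuclideanSpace ℝ (Fin 3) => u (proj w)) v =
      l * u (proj v)

theorem periodic_sin : Function.Periodic (fun t : ℝ => Real.sin (2 * Real.pi * t)) 1 := by
  intro t
  simp only [mul_add, mul_one, Real.sin_add_two_pi]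

theorem periodic_cos : Function.Periodic (fun t : ℝ => Real.cos (2 * Real.pi * t)) 1 := by
  intro t
  simp only [mul_add, mul_one, Real.cos_add_two_pi]

/-- `t ↦ sin (2 π t)` as a function on the circle `ℝ / ℤ`. -/
noncomputable def sinTwoPi (t : UnitAddCircle) : ℝ := periodic_sin.lift t

/-- `t ↦ cos (2 π t)` as a function on the circle `ℝ / ℤ`. -/
noncomputable def cosTwoPi (t : UnitAddCircle) : ℝ := periodic_cos.lift t

/-- `ψ(x, y, z) = sin (2π(x + y)) - cos (2π(y - z)) - sin (2π(x + z))` on `ℝ³ / ℤ³`. -/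
noncomputable def psi (q : T3) : ℝ :=
  sinTwoPi (q 0 + q 1) - cosTwoPi (q 1 - q 2) - sinTwoPi (q 0 + q 2)

theorem psi_proj (v : EuclideanSpace ℝ (Fin 3)) :
    psi (proj v) = Real.sin (2 * Real.pi * (v 0 + v 1)) - Real.cos (2 * Real.pi * (v 1 - v 2))
      - Real.sin (2 * Real.pi * (v 0 + v 2)) := rfl

/-- `u₊ = u χ_{u > 0}`. -/
noncomputable def pos (u : T3 → ℝ) : T3 → ℝ := Set.indicator {q | 0 < u q} u

/-- `u₋ = -u χ_{u < 0}`. -/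
noncomputable def neg (u : T3 → ℝ) : T3 → ℝ := Set.indicator {q | u q < 0} (-u)

end TorusLp

namespace TorusLp

/-! The values of ψ lie in [-3/2, 3], 3 is attained, and ψ has mean zero. The key claim is that the
density ρ of its distribution satisfies ρ(t) ≤ ρ(-t) for 0 < t < 3/2 (`psiDensity_le_neg`).

Given this, take 1 < p < ∞ and l = (3/2)^(p-1). The function u^p - l u is negative on (0, 3/2) and
positive beyond. Integrate it over ψ₊ and ψ₋: the linear terms agree by zero mean, the negative part
costs ψ₋ at least as much by the claim, and only ψ₊ reaches the positive part, on a nonempty open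
set.

For the claim, given c = cos 2π(y - z), ψ is distributed as -c + √(2(1 - c)) times the cosine of a
uniform angle, so ρ is an elliptic integral. Rescaling its interval to (0, 1) gives integrands
1/(π²√(y(1 - y)B(y))), and ρ(t), ρ(-t) are compared through B pointwise. -/

/-! ### The eigenvalue equation -/

theorem laplacian_sin_clm_add_const {ι : Type*} [Fintype ι]
    (L : EuclideanSpace ℝ ι →L[ℝ] ℝ) (c : ℝ) (v : EuclideanSpace ℝ ι) :
    Laplacian.laplacian (fun w => Real.sin (L w + c)) v =
      -(∑ i, L (EuclideanSpace.basisFun ι ℝ i) ^ 2) * Real.sin (L v + c) := by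
  have h1 : fderiv ℝ (fun w => Real.sin (L w + c)) = fun w => Real.cos (L w + c) • L := by
    funext w
    exact ((L.hasFDerivAt (x := w)).add_const c).sin.fderiv
  have h2 : fderiv ℝ (fun w => Real.cos (L w + c) • L) v =
      (-Real.sin (L v + c) • L).smulRight L :=
    (((L.hasFDerivAt (x := v)).add_const c).cos.smul_const L).fderiv
  rw [InnerProductSpace.laplacian_eq_iteratedFDeriv_orthonormalBasis _
    (EuclideanSpace.basisFun ι ℝ)]
  simp only [iteratedFDeriv_two_apply, h1, h2]
  rw [neg_mul, Finset.sum_mul, ← Finset.sum_neg_distrib]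
  refine Finset.sum_congr rfl fun i _ => ?_
  simp
  ring

/-- The linear form `v ↦ 2 π ∑ aᵢ vᵢ` on `ℝ³`. -/
noncomputable def freq (a : Fin 3 → ℝ) : EuclideanSpace ℝ (Fin 3) →L[ℝ] ℝ :=
  (2 * Real.pi) • ∑ i, a i • EuclideanSpace.proj i

theorem freq_apply (a : Fin 3 → ℝ) (v : EuclideanSpace ℝ (Fin 3)) :
    freq a v = 2 * Real.pi * (a 0 * v 0 + a 1 * v 1 + a 2 * v 2) := by
  simp [freq, Fin.sum_univ_three]
  ring

theorem sum_freq_sq (a : Fin 3 → ℝ) :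
    ∑ i, freq a (EuclideanSpace.basisFun (Fin 3) ℝ i) ^ 2 =
      4 * Real.pi ^ 2 * (a 0 ^ 2 + a 1 ^ 2 + a 2 ^ 2) := by
  simp [freq_apply, Fin.sum_univ_three]
  ring

theorem psi_proj_eq (v : EuclideanSpace ℝ (Fin 3)) :
    psi (proj v) = Real.sin (freq ![1, 1, 0] v + 0)
      - Real.sin (freq ![0, 1, -1] v + Real.pi / 2) - Real.sin (freq ![1, 0, 1] v + 0) := by
  rw [psi_proj, Real.sin_add_pi_div_two]
  simp [freq_apply, sub_eq_add_neg]

theorem psi_max : psi (proj !₂[0, 1 / 4, -1 / 4]) = 3 := by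
  rw [psi_proj]
  have e1 : 2 * Real.pi * (1 / 4) = Real.pi / 2 := by ring
  have e2 : 2 * Real.pi * (1 / 4 - -1 / 4) = Real.pi := by ring
  have e3 : 2 * Real.pi * (-1 / 4) = -(Real.pi / 2) := by ring
  simp only [Matrix.cons_val, zero_add, e1, e2, e3, Real.sin_neg,
    Real.sin_pi_div_two, Real.cos_pi]
  norm_num

theorem isLaplaceEigenfunction_psi : IsLaplaceEigenfunction psi (8 * Real.pi ^ 2) := by
  have hc (a : Fin 3 → ℝ) (c : ℝ) : ContDiff ℝ ∞ (fun v => Real.sin (freq a v + c)) :=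
    (((freq a).contDiff).add contDiff_const).sin
  have hc2 (a : Fin 3 → ℝ) (c : ℝ) (v) : ContDiffAt ℝ 2 (fun v => Real.sin (freq a v + c)) v :=
    ((((freq a).contDiff).add contDiff_const).sin).contDiffAt
  refine ⟨?_, ?_, fun v => ?_⟩
  · simp only [psi_proj_eq]
    exact ((hc _ _).sub (hc _ _)).sub (hc _ _)
  · intro h
    have := psi_max
    rw [h] at this
    norm_num at this
  · have hf : (fun w => psi (proj w)) = (((fun w => Real.sin (freq ![1, 1, 0] w + 0))
      - (fun w => Real.sin (freq ![0, 1, -1] w + Real.pi / 2)))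
      - (fun w => Real.sin (freq ![1, 0, 1] w + 0)) : EuclideanSpace ℝ (Fin 3) → ℝ) := by
      funext w
      simp only [psi_proj_eq, Pi.sub_apply]
    have h12 : ContDiffAt ℝ 2 ((fun w => Real.sin (freq ![1, 1, 0] w + 0))
      - (fun w => Real.sin (freq ![0, 1, -1] w + Real.pi / 2)) :
        EuclideanSpace ℝ (Fin 3) → ℝ) v := (hc2 _ _ v).sub (hc2 _ _ v)
    rw [hf, h12.laplacian_sub (hc2 _ _ v), (hc2 _ _ v).laplacian_sub (hc2 _ _ v),
      laplacian_sin_clm_add_const, laplacian_sin_clm_add_const, laplacian_sin_clm_add_const,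
      sum_freq_sq, sum_freq_sq, sum_freq_sq, psi_proj_eq]
    simp
    ring

/-! ### Continuity and the lower bound -/

theorem continuous_sinTwoPi : Continuous sinTwoPi :=
  continuous_quot_lift _ (by fun_prop)

theorem continuous_cosTwoPi : Continuous cosTwoPi :=
  continuous_quot_lift _ (by fun_prop)

theorem continuous_psi : Continuous psi := by
  unfold psi
  have := continuous_sinTwoPi
  have := continuous_cosTwoPi
  fun_prop

theorem proj_surjective : Function.Surjective proj := by
  intro q
  refine ⟨WithLp.toLp 2 fun i => (QuotientAddGroup.mk_surjective (q i)).choose, ?_⟩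
  funext i
  exact (QuotientAddGroup.mk_surjective (q i)).choose_spec

theorem neg_three_halves_le_psi (q : T3) : -(3 / 2) ≤ psi q := by
  obtain ⟨v, rfl⟩ := proj_surjective q
  rw [psi_proj]
  set a := 2 * Real.pi * (v 0 + v 1) with ha
  set b := 2 * Real.pi * (v 0 + v 2) with hb
  have : 2 * Real.pi * (v 1 - v 2) = a - b := by rw [ha, hb]; ring
  rw [this, Real.cos_sub]
  -- 2ψ + 3 is exactly the sum of these two squares.
  nlinarith [sq_nonneg (Real.sin a - Real.sin b + 1), sq_nonneg (Real.cos a - Real.cos b),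
    Real.sin_sq_add_cos_sq a, Real.sin_sq_add_cos_sq b]

/-! ### The distribution of ψ -/

theorem lintegral_comp_add_mul (g : ℝ → ℝ≥0∞) (b : ℝ) {a : ℝ} (ha : 0 < a) :
    ∫⁻ u, g u = ∫⁻ x, ENNReal.ofReal a * g (b + a * x) := by
  have h := lintegral_image_eq_lintegral_abs_deriv_mul (s := Set.univ) (f := fun x => b + a * x)
    (f' := fun _ => a) MeasurableSet.univ
    (fun x _ => by
      have := ((hasDerivAt_id x).const_mul a).const_add b
      rw [mul_one] at this
      exact this.hasDerivWithinAt)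
    (fun x _ x' _ h => by simpa [ha.ne'] using h) g
  have himg : (fun x => b + a * x) '' Set.univ = Set.univ := by
    refine Set.eq_univ_of_forall fun u => ⟨(u - b) / a, trivial, ?_⟩
    simp only []
    field_simp
    ring
  rwa [himg, Measure.restrict_univ, abs_of_pos ha] at h

theorem lintegral_T3 {f : T3 → ℝ≥0∞} (hf : Measurable f) :
    ∫⁻ q, f q = ∫⁻ y : UnitAddCircle, ∫⁻ z : UnitAddCircle, ∫⁻ x : UnitAddCircle,
      f ![x, y, z] := by
  have h1 := (volume_preserving_piFinSuccAbove (fun _ : Fin 3 => UnitAddCircle) 0).symm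
  have h2 := (volume_preserving_finTwoArrow UnitAddCircle).symm
  have hg := hf.comp
    (MeasurableEquiv.piFinSuccAbove (fun _ : Fin 3 => UnitAddCircle) 0).symm.measurable
  have hg' := Measurable.lintegral_prod_left' (μ := (volume : Measure UnitAddCircle)) hg
  simp only [Function.comp_apply] at hg'
  rw [← h1.lintegral_comp hf, Measure.volume_eq_prod,
    lintegral_prod_symm' (fun p : UnitAddCircle × (Fin 2 → UnitAddCircle) =>
      f ((MeasurableEquiv.piFinSuccAbove (fun _ : Fin 3 => UnitAddCircle) 0).symm p)) hg,
    ← h2.lintegral_comp hg', Measure.volume_eq_prod, lintegral_prod]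
  · refine lintegral_congr fun y => lintegral_congr fun z => lintegral_congr fun x => ?_
    congr 1
    funext i
    fin_cases i <;> rfl
  · exact (hg'.comp (MeasurableEquiv.measurable _)).aemeasurable

/-- The density of the cosine of a uniformly distributed angle. It vanishes off `(-1, 1)`, because
the square root of a nonpositive number is `0`. -/
noncomputable def arcsineDensity (c : ℝ) : ℝ := (Real.pi * √(1 - c ^ 2))⁻¹

theorem measurable_arcsineDensity : Measurable arcsineDensity := by
  unfold arcsineDensity
  fun_prop

theorem arcsineDensity_nonneg (c : ℝ) : 0 ≤ arcsineDensity c := by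
  unfold arcsineDensity
  positivity

theorem arcsineDensity_eq_zero {c : ℝ} (hc : c ∉ Set.Ioo (-1) 1) : arcsineDensity c = 0 := by
  have : 1 - c ^ 2 ≤ 0 := by
    by_contra! h
    exact hc (abs_lt.1 ((sq_lt_one_iff_abs_lt_one c).1 (by linarith)))
  simp [arcsineDensity, Real.sqrt_eq_zero_of_nonpos this]

/-- The cosine is injective on each half of the circle, with inverse ±arccos c / (2π); each half
contributes half of the density. -/
theorem lintegral_cosTwoPi (f : ℝ → ℝ≥0∞) :
    ∫⁻ t, f (cosTwoPi t) = ∫⁻ c, ENNReal.ofReal (arcsineDensity c) * f c := by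
  have hpi := Real.pi_pos
  have key (s : ℝ) (hs : s = 1 ∨ s = -1) :
      ∫⁻ t in (fun c => s * Real.arccos c / (2 * Real.pi)) '' Set.Ioo (-1) 1,
        f (Real.cos (2 * Real.pi * t)) =
      ∫⁻ c in Set.Ioo (-1) 1, ENNReal.ofReal (arcsineDensity c / 2) * f c := by
    rw [lintegral_image_eq_lintegral_abs_deriv_mul measurableSet_Ioo
      (f' := fun c => s * (-(1 / √(1 - c ^ 2))) / (2 * Real.pi))]
    · refine setLIntegral_congr_fun measurableSet_Ioo fun c hc => ?_
      have h1 : 2 * Real.pi * (s * Real.arccos c / (2 * Real.pi)) = s * Real.arccos c := by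
        field_simp
      have h2 : Real.cos (s * Real.arccos c) = c := by
        rcases hs with rfl | rfl <;> simp [Real.cos_arccos hc.1.le hc.2.le]
      have h3 : |s * (-(1 / √(1 - c ^ 2))) / (2 * Real.pi)| = arcsineDensity c / 2 := by
        have : |s| = 1 := by rcases hs with rfl | rfl <;> simp
        rw [abs_div, abs_mul, this, abs_neg, abs_of_nonneg (by positivity : 0 ≤ 1 / √(1 - c ^ 2)),
          abs_of_pos (by positivity), arcsineDensity]
        ring
      simp only [h1, h2, h3]
    · intro c hc
      exact (((Real.hasDerivAt_arccos hc.1.ne' hc.2.ne).const_mul s).div_const _).hasDerivWithinAt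
    · intro c hc d hd h
      have hs0 : s ≠ 0 := by rcases hs with rfl | rfl <;> norm_num
      have : Real.arccos c = Real.arccos d := by
        field_simp at h
        exact h
      exact Real.arccos_injOn ⟨hc.1.le, hc.2.le⟩ ⟨hd.1.le, hd.2.le⟩ this
  have him1 : (fun c => 1 * Real.arccos c / (2 * Real.pi)) '' Set.Ioo (-1) 1 =
      Set.Ioo 0 (1 / 2) := by
    ext t
    constructor
    · rintro ⟨c, hc, rfl⟩
      have h0 := Real.arccos_pos.2 hc.2
      have h1 : Real.arccos c < Real.pi := by
        rw [Real.arccos_lt_pi]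
        exact hc.1
      refine ⟨by positivity, ?_⟩
      simp only []
      rw [div_lt_div_iff₀ (by positivity) (by norm_num)]
      linarith
    · rintro ⟨h0, h1⟩
      have ha : 0 < 2 * Real.pi * t := by positivity
      have hb : 2 * Real.pi * t < Real.pi := by nlinarith
      refine ⟨Real.cos (2 * Real.pi * t), ⟨?_, ?_⟩, ?_⟩
      · rw [← Real.cos_pi]
        exact Real.cos_lt_cos_of_nonneg_of_le_pi ha.le le_rfl hb
      · rw [← Real.cos_zero]
        exact Real.cos_lt_cos_of_nonneg_of_le_pi le_rfl hb.le ha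
      · simp only [Real.arccos_cos ha.le hb.le]
        field_simp
  have him2 : (fun c => -1 * Real.arccos c / (2 * Real.pi)) '' Set.Ioo (-1) 1 =
      Set.Ioo (-(1 / 2)) 0 := by
    have : (fun c => -1 * Real.arccos c / (2 * Real.pi)) =
        Neg.neg ∘ (fun c => 1 * Real.arccos c / (2 * Real.pi)) := by
      funext c
      simp only [Function.comp]
      ring
    rw [this, Set.image_comp, him1]
    simp
  have hsum := UnitAddCircle.lintegral_preimage (-(1 / 2)) (fun t => f (cosTwoPi t))
  rw [← hsum, show (-(1 / 2) + 1 : ℝ) = 1 / 2 by norm_num,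
    ← Set.Ioc_union_Ioc_eq_Ioc (by norm_num : (-(1 / 2) : ℝ) ≤ 0) (by norm_num : (0 : ℝ) ≤ 1 / 2),
    lintegral_union measurableSet_Ioc (Set.Ioc_disjoint_Ioc_of_le le_rfl),
    setLIntegral_congr Ioo_ae_eq_Ioc.symm, setLIntegral_congr Ioo_ae_eq_Ioc.symm]
  have hcoe (t : ℝ) : cosTwoPi (t : UnitAddCircle) = Real.cos (2 * Real.pi * t) := rfl
  simp only [hcoe]
  rw [← him2, ← him1, key 1 (Or.inl rfl), key (-1) (Or.inr rfl), ← two_mul,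
    ← lintegral_const_mul' _ _ (by norm_num), ← lintegral_indicator measurableSet_Ioo]
  refine lintegral_congr fun c => ?_
  by_cases hc : c ∈ Set.Ioo (-1) 1
  · rw [Set.indicator_of_mem hc, ← mul_assoc, ← ENNReal.ofReal_ofNat 2,
      ← ENNReal.ofReal_mul (by norm_num)]
    congr 2
    ring
  · rw [Set.indicator_of_notMem hc, arcsineDensity_eq_zero hc]
    simp

/-- With e = y - z, sum-to-product turns the two sines into 2 sin(πe) cos 2π(x + z + e/2), and
translation in x removes the phase. -/
theorem lintegral_comp_psi_fst (f : ℝ → ℝ≥0∞) (y z : UnitAddCircle) :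
    ∫⁻ x, f (psi ![x, y, z]) = ∫⁻ t, f (-cosTwoPi (y - z) +
      √(2 * (1 - cosTwoPi (y - z))) * cosTwoPi t) := by
  obtain ⟨d, rfl⟩ := QuotientAddGroup.mk_surjective z
  -- A representative in [0, 1) makes sin(πe) nonnegative, so that 2 sin(πe) is the square root
  -- without a sign.
  obtain ⟨e, he, hy⟩ : ∃ e ∈ Set.Ico (0 : ℝ) (0 + 1),
      (e : UnitAddCircle) = y - (d : UnitAddCircle) := by
    have := (AddCircle.coe_image_Ico_eq 1 0).ge (Set.mem_univ (y - (d : UnitAddCircle)))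
    exact this
  obtain rfl : y = ((e + d : ℝ) : UnitAddCircle) := by
    rw [AddCircle.coe_add, hy, sub_add_cancel]
  have hs : √(2 * (1 - Real.cos (2 * Real.pi * e))) = 2 * Real.sin (Real.pi * e) := by
    have h0 : 0 ≤ Real.sin (Real.pi * e) :=
      Real.sin_nonneg_of_nonneg_of_le_pi (mul_nonneg Real.pi_pos.le he.1)
        (by nlinarith [Real.pi_pos, he.2])
    rw [show 2 * (1 - Real.cos (2 * Real.pi * e)) = (2 * Real.sin (Real.pi * e)) ^ 2 by
      rw [mul_assoc, Real.cos_two_mul, Real.cos_sq']; ring, Real.sqrt_sq (by positivity)]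
  have hcoe (t : ℝ) : cosTwoPi (t : UnitAddCircle) = Real.cos (2 * Real.pi * t) := rfl
  have ht := lintegral_add_right_eq_self (μ := volume) (fun t : UnitAddCircle =>
    f (-Real.cos (2 * Real.pi * e) + 2 * Real.sin (Real.pi * e) * cosTwoPi t))
    ((d + e / 2 : ℝ) : UnitAddCircle)
  have hyz : ((e + d : ℝ) : UnitAddCircle) - (QuotientAddGroup.mk d : UnitAddCircle) = (e : ℝ) :=
    hy.symm
  rw [hyz, hcoe, hs, ← ht]
  refine lintegral_congr fun x => ?_
  obtain ⟨a, rfl⟩ := QuotientAddGroup.mk_surjective x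
  have : psi ![(a : UnitAddCircle), ((e + d : ℝ) : UnitAddCircle), (d : UnitAddCircle)] =
      Real.sin (2 * Real.pi * (a + (e + d))) - Real.cos (2 * Real.pi * ((e + d) - d))
      - Real.sin (2 * Real.pi * (a + d)) := rfl
  congr 1
  refine this.trans ?_
  change _ = -Real.cos (2 * Real.pi * e) + 2 * Real.sin (Real.pi * e) *
    Real.cos (2 * Real.pi * (a + (d + e / 2)))
  rw [add_sub_cancel_right,
    show 2 * Real.pi * (a + (e + d)) = 2 * Real.pi * (a + (d + e / 2)) + Real.pi * e by ring,
    show 2 * Real.pi * (a + d) = 2 * Real.pi * (a + (d + e / 2)) - Real.pi * e by ring,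
    Real.sin_add, Real.sin_sub]
  ring

/-- The density of the distribution of `psi`. -/
noncomputable def psiDensity (u : ℝ) : ℝ≥0∞ :=
  ∫⁻ c, ENNReal.ofReal (arcsineDensity c * (Real.pi * √(3 + 2 * u - (c + 1 + u) ^ 2))⁻¹)

/-- Condition on c and substitute u = -c + √(2(1 - c)) e; the radicand is 2(1 - c) - (c + u)². -/
theorem lintegral_comp_psi {f : ℝ → ℝ≥0∞} (hf : Measurable f) :
    ∫⁻ q, f (psi q) = ∫⁻ u, psiDensity u * f u := by
  have hmc := measurable_arcsineDensity
  rw [lintegral_T3 (f := fun q => f (psi q)) (hf.comp continuous_psi.measurable)]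
  simp only [lintegral_comp_psi_fst]
  have h1 (y : UnitAddCircle) := lintegral_sub_left_eq_self (μ := volume)
    (fun w : UnitAddCircle => ∫⁻ t, f (-cosTwoPi w + √(2 * (1 - cosTwoPi w)) * cosTwoPi t)) y
  simp only [h1, lintegral_const, UnitAddCircle.measure_univ, mul_one]
  rw [lintegral_cosTwoPi (fun c => ∫⁻ t, f (-c + √(2 * (1 - c)) * cosTwoPi t))]
  have h2 (c : ℝ) : ENNReal.ofReal (arcsineDensity c) *
      ∫⁻ t, f (-c + √(2 * (1 - c)) * cosTwoPi t) =
      ∫⁻ u, ENNReal.ofReal (arcsineDensity c *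
        (Real.pi * √(3 + 2 * u - (c + 1 + u) ^ 2))⁻¹) * f u := by
    by_cases hc : c ∈ Set.Ioo (-1) 1
    swap
    · simp [arcsineDensity_eq_zero hc]
    rw [lintegral_cosTwoPi (fun e => f (-c + √(2 * (1 - c)) * e))]
    set a := √(2 * (1 - c)) with ha
    have ha0 : 0 < a := Real.sqrt_pos.2 (by linarith [hc.2])
    have ha2 : a ^ 2 = 2 * (1 - c) := Real.sq_sqrt (by linarith [hc.2])
    have hsub := lintegral_comp_add_mul (fun u => ENNReal.ofReal (arcsineDensity c *
      (Real.pi * √(3 + 2 * u - (c + 1 + u) ^ 2))⁻¹) * f u) (-c) ha0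
    rw [hsub, ← lintegral_const_mul' _ _ ENNReal.ofReal_ne_top]
    refine lintegral_congr fun e => ?_
    rw [← mul_assoc, ← mul_assoc, ← ENNReal.ofReal_mul (arcsineDensity_nonneg c),
      ← ENNReal.ofReal_mul ha0.le]
    congr 2
    have : 3 + 2 * (-c + a * e) - (c + 1 + (-c + a * e)) ^ 2 = a ^ 2 * (1 - e ^ 2) := by
      linear_combination -ha2
    rw [this, Real.sqrt_mul (sq_nonneg a), Real.sqrt_sq ha0.le, arcsineDensity, arcsineDensity]
    field_simp
  simp only [h2]
  rw [lintegral_lintegral_swap]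
  · refine lintegral_congr fun u => ?_
    rw [psiDensity, lintegral_mul_const]
    fun_prop
  · apply Measurable.aemeasurable
    unfold Function.uncurry
    fun_prop

/-! ### Comparison of the densities at t and -t -/

/-- Substitute c = a + L y: the Jacobian L cancels the L² under the root. Off (0, 1) a radicand is
nonpositive, so its root and the inverse are 0. -/
theorem psiDensity_eq_setLIntegral {u a L : ℝ} (hL : 0 < L) {B : ℝ → ℝ}
    (hB : ∀ y, (1 - (a + L * y) ^ 2) * (3 + 2 * u - (a + L * y + 1 + u) ^ 2) =
      L ^ 2 * (y * (1 - y) * B y))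
    (hin : ∀ y ∈ Set.Ioo (0 : ℝ) 1, 0 ≤ 1 - (a + L * y) ^ 2)
    (hout : ∀ y ∉ Set.Ioo (0 : ℝ) 1,
      1 - (a + L * y) ^ 2 ≤ 0 ∨ 3 + 2 * u - (a + L * y + 1 + u) ^ 2 ≤ 0) :
    psiDensity u =
      ∫⁻ y in Set.Ioo 0 1, ENNReal.ofReal (Real.pi ^ 2 * √(y * (1 - y) * B y))⁻¹ := by
  rw [psiDensity, lintegral_comp_add_mul _ a hL, ← lintegral_indicator measurableSet_Ioo]
  refine lintegral_congr fun y => ?_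
  rw [← ENNReal.ofReal_mul hL.le, arcsineDensity]
  by_cases hy : y ∈ Set.Ioo (0 : ℝ) 1
  · rw [Set.indicator_of_mem hy]
    congr 1
    have h := Real.sqrt_mul (hin y hy) (3 + 2 * u - (a + L * y + 1 + u) ^ 2)
    rw [hB, Real.sqrt_mul (sq_nonneg L), Real.sqrt_sq hL.le] at h
    rw [← mul_inv, mul_mul_mul_comm, ← h, ← sq]
    field_simp
  · rw [Set.indicator_of_notMem hy]
    rcases hout y hy with h | h <;> simp [Real.sqrt_eq_zero_of_nonpos h]

/-- The part of the density of `psi` at `(r ^ 2 - 3) / 2`, for `1 < r`, that depends on `r`: it is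
increasing in `r`. -/
noncomputable def outerKernel (r y : ℝ) : ℝ :=
  (2 - 2 * y + y * ((r - 1) ^ 2 / 2)) * ((r + 1) ^ 2 / 2 - 2 + 2 * y - y * ((r - 1) ^ 2 / 2))

/-- Since r² = 3 + 2u, the second radicand has roots 1 - (r ± 1)²/2. Here the lower one is below -1,
so c runs from -1 to 1 - (r - 1)²/2; the kernel collects the other two linear factors. -/
theorem psiDensity_of_one_lt {r : ℝ} (h1 : 1 < r) (h3 : r < 3) :
    psiDensity ((r ^ 2 - 3) / 2) = ∫⁻ y in Set.Ioo 0 1,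
      ENNReal.ofReal (Real.pi ^ 2 * √(y * (1 - y) * outerKernel r y))⁻¹ := by
  have hL : 0 < 2 - (r - 1) ^ 2 / 2 := by nlinarith
  refine psiDensity_eq_setLIntegral (a := -1) (L := 2 - (r - 1) ^ 2 / 2) hL ?_ ?_ ?_
  · intro y
    unfold outerKernel
    ring
  · rintro y ⟨hy0, hy1⟩
    nlinarith [mul_pos hL hy0, mul_nonneg hL.le (sub_nonneg.2 hy1.le), sq_nonneg (r - 1)]
  · intro y hy
    rcases le_or_gt y 0 with hy0 | hy0
    · left
      nlinarith [mul_nonneg hL.le (neg_nonneg.2 hy0)]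
    · right
      have hy1 : 1 ≤ y := not_lt.1 fun h => hy ⟨hy0, h⟩
      have h2 : 0 ≤ (2 - (r - 1) ^ 2 / 2) * (y - 1) := mul_nonneg hL.le (sub_nonneg.2 hy1)
      nlinarith

theorem innerKernel_pos {r y : ℝ} (h0 : 0 < r) (h1 : r ≤ 1) (hy0 : 0 < y) (hy1 : y < 1) :
    0 < 1 - (1 - (r + 1) ^ 2 / 2 + 2 * r * y) ^ 2 := by
  have e1 : 0 < 1 - (1 - (r + 1) ^ 2 / 2 + 2 * r * y) := by
    linarith [mul_pos h0 (sub_pos.2 hy1), sq_nonneg (r - 1)]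
  have e2 : 0 < 1 + (1 - (r + 1) ^ 2 / 2 + 2 * r * y) := by
    nlinarith [mul_pos h0 hy0]
  linarith [mul_pos e1 e2]

/-- Now both roots 1 - (r ± 1)²/2 lie in [-1, 1], so c runs between them and the remaining factor is
1 - c². -/
theorem psiDensity_of_le_one {r : ℝ} (h0 : 0 < r) (h1 : r ≤ 1) :
    psiDensity ((r ^ 2 - 3) / 2) = ∫⁻ y in Set.Ioo 0 1,
      ENNReal.ofReal (Real.pi ^ 2 * √(y * (1 - y) *
        (1 - (1 - (r + 1) ^ 2 / 2 + 2 * r * y) ^ 2)))⁻¹ := by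
  refine psiDensity_eq_setLIntegral (a := 1 - (r + 1) ^ 2 / 2) (L := 2 * r) (by positivity)
    ?_ ?_ ?_
  · intro y
    ring
  · rintro y ⟨hy0, hy1⟩
    exact (innerKernel_pos h0 h1 hy0 hy1).le
  · intro y hy
    right
    have hy' : y * (1 - y) ≤ 0 := by
      by_contra! h
      refine hy ⟨?_, ?_⟩ <;> nlinarith
    nlinarith [mul_nonneg (sq_nonneg r) (neg_nonneg.2 hy')]

/-- Strict positivity of the smaller kernel matters: the inverse of 0 is 0, which would break
monotonicity. -/
theorem setLIntegral_inv_sqrt_anti {B C : ℝ → ℝ}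
    (hC : ∀ y ∈ Set.Ioo (0 : ℝ) 1, 0 < C y) (h : ∀ y ∈ Set.Ioo (0 : ℝ) 1, C y ≤ B y) :
    ∫⁻ y in Set.Ioo 0 1, ENNReal.ofReal (Real.pi ^ 2 * √(y * (1 - y) * B y))⁻¹ ≤
      ∫⁻ y in Set.Ioo 0 1, ENNReal.ofReal (Real.pi ^ 2 * √(y * (1 - y) * C y))⁻¹ := by
  refine setLIntegral_mono' measurableSet_Ioo fun y hy => ENNReal.ofReal_le_ofReal ?_
  have h1 : 0 < y * (1 - y) := mul_pos hy.1 (sub_pos.2 hy.2)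
  have h2 := hC y hy
  have h3 := h y hy
  gcongr

theorem psiDensity_le_neg {t : ℝ} (h0 : 0 < t) (h1 : t < 3 / 2) :
    psiDensity t ≤ psiDensity (-t) := by
  obtain ⟨r, hr, hrt⟩ : ∃ r, 0 < r ∧ r ^ 2 = 3 + 2 * t :=
    ⟨√(3 + 2 * t), Real.sqrt_pos.2 (by linarith), Real.sq_sqrt (by linarith)⟩
  obtain ⟨s, hs, hst⟩ : ∃ s, 0 < s ∧ s ^ 2 = 3 - 2 * t :=
    ⟨√(3 - 2 * t), Real.sqrt_pos.2 (by linarith), Real.sq_sqrt (by linarith)⟩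
  have ht : t = (r ^ 2 - 3) / 2 := by linarith
  have ht' : -t = (s ^ 2 - 3) / 2 := by linarith
  have hr1 : 1 < r := by nlinarith
  have hr3 : r < 3 := by nlinarith
  have hsr : s < r := by nlinarith
  rw [ht', ht, psiDensity_of_one_lt hr1 hr3]
  rcases lt_or_ge 1 s with hs1 | hs1
  · rw [psiDensity_of_one_lt hs1 (by linarith)]
    have f1 (y : ℝ) (hy : y ∈ Set.Ioo (0 : ℝ) 1) : 0 < 2 - 2 * y + y * ((s - 1) ^ 2 / 2) := by
      linarith [mul_nonneg hy.1.le (sq_nonneg (s - 1)), hy.2]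
    have f2 (y : ℝ) (hy : y ∈ Set.Ioo (0 : ℝ) 1) :
        0 < (s + 1) ^ 2 / 2 - 2 + 2 * y - y * ((s - 1) ^ 2 / 2) := by
      nlinarith [mul_pos hy.1 hs, mul_pos (sub_pos.2 hy.2) (sub_pos.2 hs1), sq_nonneg (s - 1)]
    refine setLIntegral_inv_sqrt_anti (fun y hy => mul_pos (f1 y hy) (f2 y hy)) fun y hy => ?_
    refine mul_le_mul ?_ ?_ (f2 y hy).le ((f1 y hy).le.trans ?_)
    · gcongr
      exact hy.1.le
    · nlinarith [mul_pos (sub_pos.2 hsr) (sub_pos.2 hy.2), mul_pos hy.1 (sub_pos.2 hsr),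
        mul_pos (sub_pos.2 hsr) (mul_pos (sub_pos.2 hy.2) hs), mul_pos (sub_pos.2 hsr)
        (mul_pos (sub_pos.2 hy.2) hr)]
    · gcongr
      exact hy.1.le
  · rw [psiDensity_of_le_one hs hs1]
    -- As r² + s² = 6 and s ≤ 1, r is large enough for the outer kernel to be at least 1, while the
    -- inner kernel 1 - c² is at most 1.
    have hr5 : 5 ≤ r ^ 2 := by nlinarith
    have hr2 : 11 / 5 < r := by nlinarith
    refine setLIntegral_inv_sqrt_anti (fun y hy => innerKernel_pos hs hs1 hy.1 hy.2)
      fun y hy => ?_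
    refine le_trans (b := 1) (sub_le_self _ (sq_nonneg _)) ?_
    have k1 : 1 ≤ (r - 1) ^ 2 := by nlinarith
    have k2 : (r - 1) ^ 2 ≤ 4 := by nlinarith
    have k3 : 10 ≤ (r + 1) ^ 2 := by nlinarith
    have e1 : 1 / 2 ≤ 2 - 2 * y + y * ((r - 1) ^ 2 / 2) := by
      linarith [mul_nonneg hy.1.le (sub_nonneg.2 k1), hy.2]
    have e2 : 2 ≤ (r + 1) ^ 2 / 2 - 2 + 2 * y - y * ((r - 1) ^ 2 / 2) := by
      linarith [mul_nonneg hy.1.le (sub_nonneg.2 k2)]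
    calc (1 : ℝ) = 1 / 2 * 2 := by norm_num
      _ ≤ outerKernel r y := mul_le_mul e1 e2 (by norm_num) (by linarith)

theorem lintegral_comp_psi_le {f : ℝ → ℝ≥0∞} (hf : Measurable f)
    (h0 : ∀ u ∉ Set.Ioo (0 : ℝ) (3 / 2), f u = 0) :
    ∫⁻ q, f (psi q) ≤ ∫⁻ q, f (-psi q) := by
  rw [lintegral_comp_psi hf, lintegral_comp_psi (f := fun u => f (-u)) (hf.comp measurable_neg),
    ← lintegral_neg_eq_self (fun u => psiDensity u * f (-u))]
  refine lintegral_mono fun u => ?_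
  simp only [neg_neg]
  by_cases hu : u ∈ Set.Ioo (0 : ℝ) (3 / 2)
  · gcongr
    exact psiDensity_le_neg hu.1 hu.2
  · simp [h0 u hu]

/-! ### Zero mean -/

theorem sinTwoPi_add_half (t : UnitAddCircle) :
    sinTwoPi (t + ((1 / 2 : ℝ) : UnitAddCircle)) = -sinTwoPi t := by
  obtain ⟨a, rfl⟩ := QuotientAddGroup.mk_surjective t
  change Real.sin (2 * Real.pi * (a + 1 / 2)) = -Real.sin (2 * Real.pi * a)
  rw [← Real.sin_add_pi]
  ring_nf

theorem cosTwoPi_add_half (t : UnitAddCircle) :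
    cosTwoPi (t + ((1 / 2 : ℝ) : UnitAddCircle)) = -cosTwoPi t := by
  obtain ⟨a, rfl⟩ := QuotientAddGroup.mk_surjective t
  change Real.cos (2 * Real.pi * (a + 1 / 2)) = -Real.cos (2 * Real.pi * a)
  rw [← Real.cos_add_pi]
  ring_nf

theorem integral_eq_zero_of_add_eq_neg {G : Type*} [AddGroup G] [MeasurableSpace G]
    [MeasurableAdd G] {μ : Measure G} [μ.IsAddRightInvariant] {f : G → ℝ} (g : G)
    (h : ∀ q, f (q + g) = -f q) : ∫ q, f q ∂μ = 0 := by
  have := integral_add_right_eq_self (μ := μ) f g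
  simp only [h, integral_neg] at this
  linarith

theorem integral_psi : ∫ q, psi q = 0 := by
  have hs := continuous_sinTwoPi
  have hc := continuous_cosTwoPi
  have hint {f : T3 → ℝ} (hf : Continuous f) : Integrable f :=
    hf.integrable_of_hasCompactSupport (HasCompactSupport.of_compactSpace f)
  unfold psi
  rw [integral_sub (hint (by fun_prop)) (hint (by fun_prop)),
    integral_sub (hint (by fun_prop)) (hint (by fun_prop)),
    integral_eq_zero_of_add_eq_neg (Pi.single 0 ((1 / 2 : ℝ) : UnitAddCircle)) fun q => ?_,
    integral_eq_zero_of_add_eq_neg (Pi.single 1 ((1 / 2 : ℝ) : UnitAddCircle)) fun q => ?_,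
    integral_eq_zero_of_add_eq_neg (Pi.single 0 ((1 / 2 : ℝ) : UnitAddCircle)) fun q => ?_]
  · simp
  · rw [← sinTwoPi_add_half]
    congr 1
    simp
    abel
  · rw [← cosTwoPi_add_half]
    congr 1
    simp
    abel
  · rw [← sinTwoPi_add_half]
    congr 1
    simp
    abel

theorem lintegral_ofReal_neg_psi_ne_top : ∫⁻ q, ENNReal.ofReal (-psi q) ≠ ⊤ := by
  have hint : Integrable (fun q => -psi q) :=
    continuous_psi.neg.integrable_of_hasCompactSupport (HasCompactSupport.of_compactSpace _)
  exact hint.lintegral_lt_top.ne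

theorem lintegral_ofReal_psi :
    ∫⁻ q, ENNReal.ofReal (psi q) = ∫⁻ q, ENNReal.ofReal (-psi q) := by
  have hint : Integrable psi :=
    continuous_psi.integrable_of_hasCompactSupport (HasCompactSupport.of_compactSpace psi)
  have h := integral_eq_lintegral_pos_part_sub_lintegral_neg_part hint
  rw [integral_psi] at h
  exact (ENNReal.toReal_eq_toReal_iff' hint.lintegral_lt_top.ne lintegral_ofReal_neg_psi_ne_top).1
    (by linarith)

/-! ### Comparison of the norms -/

theorem measure_three_halves_lt_psi : 0 < volume {q | 3 / 2 < psi q} :=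
  (isOpen_lt continuous_const continuous_psi).measure_pos _
    ⟨proj !₂[0, 1 / 4, -1 / 4], by rw [Set.mem_ofPred_eq, psi_max]; norm_num⟩

theorem enorm_pos (u : T3 → ℝ) (q : T3) : ‖pos u q‖ₑ = ENNReal.ofReal (u q) := by
  unfold pos
  by_cases h : 0 < u q
  · rw [Set.indicator_of_mem (by exact h), Real.enorm_of_nonneg h.le]
  · rw [Set.indicator_of_notMem (by exact h), ENNReal.ofReal_of_nonpos (not_lt.1 h), enorm_zero]

theorem enorm_neg (u : T3 → ℝ) (q : T3) : ‖neg u q‖ₑ = ENNReal.ofReal (-u q) := by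
  unfold neg
  by_cases h : u q < 0
  · rw [Set.indicator_of_mem (by exact h), Pi.neg_apply, Real.enorm_of_nonneg (by linarith)]
  · rw [Set.indicator_of_notMem (by exact h), ENNReal.ofReal_of_nonpos (by linarith), enorm_zero]

theorem eLpNorm_top_neg_lt_pos : eLpNorm (neg psi) ⊤ volume < eLpNorm (pos psi) ⊤ volume := by
  refine lt_of_le_of_lt (b := ENNReal.ofReal (3 / 2)) ?_ ?_
  · rw [eLpNorm_exponent_top]
    refine eLpNormEssSup_le_of_ae_enorm_bound (.of_forall fun q => ?_)
    rw [enorm_neg]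
    exact ENNReal.ofReal_le_ofReal (by linarith [neg_three_halves_le_psi q])
  · by_contra! h
    rw [eLpNorm_exponent_top] at h
    have h1 := ae_le_eLpNormEssSup (f := pos psi) (μ := (volume : Measure T3))
    refine measure_three_halves_lt_psi.ne' (measure_mono_null (fun q hq => ?_) (ae_iff.1 h1))
    have hq' : 3 / 2 < psi q := hq
    refine not_le.2 (h.trans_lt ?_)
    rw [enorm_pos]
    exact (ENNReal.ofReal_lt_ofReal_iff (by linarith)).2 hq'

theorem mul_rpow_sub_one {x p : ℝ} (hx : 0 ≤ x) (hp : 1 < p) : x ^ p = x ^ (p - 1) * x := by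
  rcases hx.eq_or_lt with rfl | hx
  · rw [Real.zero_rpow (by linarith), mul_zero]
  · rw [Real.rpow_sub_one hx.ne', div_mul_cancel₀ _ hx.ne']

theorem lintegral_rpow_neg_lt_pos {p : ℝ} (hp : 1 < p) :
    ∫⁻ q, ENNReal.ofReal (-psi q) ^ p < ∫⁻ q, ENNReal.ofReal (psi q) ^ p := by
  set l : ℝ := (3 / 2) ^ (p - 1) with hl
  have hl0 : 0 ≤ l := by positivity
  have hmono {x : ℝ} (hx : 0 ≤ x) (h : x ≤ 3 / 2) : x ^ p ≤ l * x := by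
    rw [mul_rpow_sub_one hx hp]
    exact mul_le_mul_of_nonneg_right (Real.rpow_le_rpow hx h (by linarith)) hx
  have hmono' {x : ℝ} (h : 3 / 2 < x) : l * x < x ^ p := by
    rw [mul_rpow_sub_one (by linarith) hp]
    exact mul_lt_mul_of_pos_right (Real.rpow_lt_rpow (by norm_num) h (by linarith)) (by linarith)
  -- `k` and `j` are the negative and positive parts of u₊^p - l u₊, supported in (0, 3/2) and (3/2,
  -- ∞); splitting avoids subtraction in `ℝ≥0∞`.
  let k (u : ℝ) : ℝ≥0∞ := ENNReal.ofReal (l * max u 0 - max u 0 ^ p)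
  let j (u : ℝ) : ℝ≥0∞ := ENNReal.ofReal (max u 0 ^ p - l * max u 0)
  have hk : Measurable k := by fun_prop
  have hj : Measurable j := by fun_prop
  have hψ := continuous_psi.measurable
  have hkψ : Measurable fun q => k (psi q) := hk.comp hψ
  have hkψ' : Measurable fun q => k (-psi q) := hk.comp hψ.neg
  have hjψ : Measurable fun q => j (psi q) := hj.comp hψ
  have hk0 (u : ℝ) (hu : u ∉ Set.Ioo (0 : ℝ) (3 / 2)) : k u = 0 := by
    refine ENNReal.ofReal_of_nonpos ?_
    rcases le_or_gt u 0 with h | h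
    · rw [max_eq_right h, Real.zero_rpow (by linarith)]
      simp
    · have : 3 / 2 ≤ u := not_lt.1 fun h' => hu ⟨h, h'⟩
      rw [max_eq_left h.le]
      rcases this.eq_or_lt with h' | h'
      · rw [mul_rpow_sub_one h.le hp, hl, h', sub_self]
      · linarith [hmono' h']
  have hkj (u : ℝ) :
      ENNReal.ofReal u ^ p + k u = ENNReal.ofReal l * ENNReal.ofReal u + j u := by
    have h1 : ENNReal.ofReal u = ENNReal.ofReal (max u 0) := by simp
    have h0 := le_max_right u 0
    rw [h1, ENNReal.ofReal_rpow_of_nonneg h0 (by linarith), ← ENNReal.ofReal_mul hl0]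
    simp only [k, j]
    rcases le_total (l * max u 0) (max u 0 ^ p) with h | h
    · rw [ENNReal.ofReal_of_nonpos (sub_nonpos.2 h), add_zero,
        ← ENNReal.ofReal_add (by positivity) (sub_nonneg.2 h), add_sub_cancel]
    · rw [ENNReal.ofReal_of_nonpos (sub_nonpos.2 h), add_zero,
        ← ENNReal.ofReal_add (by positivity) (sub_nonneg.2 h), add_sub_cancel]
  have hpos : (∫⁻ q, ENNReal.ofReal (psi q) ^ p) + ∫⁻ q, k (psi q) =
      ENNReal.ofReal l * (∫⁻ q, ENNReal.ofReal (psi q)) + ∫⁻ q, j (psi q) := by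
    rw [← lintegral_const_mul _ (by fun_prop), ← lintegral_add_right _ hkψ,
      ← lintegral_add_right _ hjψ]
    exact lintegral_congr fun q => hkj _
  have hneg : (∫⁻ q, ENNReal.ofReal (-psi q) ^ p) + ∫⁻ q, k (-psi q) =
      ENNReal.ofReal l * ∫⁻ q, ENNReal.ofReal (-psi q) := by
    rw [← lintegral_const_mul _ (by fun_prop), ← lintegral_add_right _ hkψ']
    refine lintegral_congr fun q => (hkj _).trans ((congrArg _ ?_).trans (add_zero _))
    refine ENNReal.ofReal_of_nonpos (sub_nonpos.2 (hmono (le_max_right _ _) ?_))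
    exact max_le (by linarith [neg_three_halves_le_psi q]) (by norm_num)
  have hjpos : 0 < ∫⁻ q, j (psi q) := by
    rw [lintegral_pos_iff_support hjψ]
    refine measure_three_halves_lt_psi.trans_le (measure_mono fun q hq => ?_)
    have hq' : 3 / 2 < psi q := hq
    simp only [j, Function.mem_support]
    rw [max_eq_left (by linarith)]
    exact (ENNReal.ofReal_pos.2 (sub_pos.2 (hmono' hq'))).ne'
  by_contra! h
  have hle := add_le_add h (lintegral_comp_psi_le hk hk0)
  rw [hpos, hneg, lintegral_ofReal_psi] at hle
  exact hle.not_gt (ENNReal.lt_add_right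
    (ENNReal.mul_ne_top ENNReal.ofReal_ne_top lintegral_ofReal_neg_psi_ne_top) hjpos.ne')

theorem eLpNorm_neg_lt_pos {p : ℝ≥0∞} (hp : 1 < p) :
    eLpNorm (neg psi) p volume < eLpNorm (pos psi) p volume := by
  rcases eq_or_ne p ⊤ with rfl | htop
  · exact eLpNorm_top_neg_lt_pos
  have hp0 : p ≠ 0 := (zero_lt_one.trans hp).ne'
  have hp1 : 1 < p.toReal := by
    simpa using (ENNReal.toReal_lt_toReal ENNReal.one_ne_top htop).2 hp
  rw [eLpNorm_eq_lintegral_rpow_enorm_toReal hp0 htop,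
    eLpNorm_eq_lintegral_rpow_enorm_toReal hp0 htop]
  simp only [enorm_pos, enorm_neg]
  exact ENNReal.rpow_lt_rpow (lintegral_rpow_neg_lt_pos hp1) (by positivity)

end TorusLp

theorem proposition2p1 :
    TorusLp.IsLaplaceEigenfunction TorusLp.psi (8 * Real.pi ^ 2) ∧
    ∀ p : ℝ≥0∞, 1 < p →
      eLpNorm (TorusLp.neg TorusLp.psi) p volume < eLpNorm (TorusLp.pos TorusLp.psi) p volume ∧
      eLpNorm (TorusLp.pos TorusLp.psi) p volume ≠ eLpNorm (TorusLp.neg TorusLp.psi) p volume :=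
  ⟨TorusLp.isLaplaceEigenfunction_psi, fun _ hp =>
    ⟨TorusLp.eLpNorm_neg_lt_pos hp, (TorusLp.eLpNorm_neg_lt_pos hp).ne'⟩⟩
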